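/- Let $K\subset\mathbb R^n_q$ and $T\subset\mathbb R^n_p$ be bounded strictly convex bodies (nonempty open sets) with $C^6$-smooth boundaries, and let $\vec n$ denote the exterior unit normal fields of $\partial K$ and $\partial T$. Consider $K\times T$ in $\mathbb R^{2n}$ with the symplectic form $\omega=\sum_j dq_j\wedge dp_j$. A $(K,T)$-billiard orbit is a continuous oriented curve in $\partial(K\times T)$ whose intersection with $(K\times\partial T)\cup(\partial K\times T)$ is tangent to the characteristic line field, i.e. the field of kernels of the restriction of $\omega$ to the tangent spaces of $\partial (K\times T)$, and is co-directed with $(\vec n(p),0)$ at $(q,p)\in K\times\partial T$ and with $(0,-\vec n(q))$ at $(q,p)\in\partial K\times T$. For $q\in\partial K$ the reflection map $R_{K,q}$ sends an oriented line $L_0$ through $q$ directed outside $K$ at $q$ to the oriented line $L_1$ through $q$, directed inside $K$, such that some $(K,T)$-billiard orbit has its $q$-component arriving at $q$ from inside $K$ along $L_0$, then has its $q$-component resting at $q$ while its $p$-component crosses $T$, and then has its $q$-component leaving $q$ into $K$ along $L_1$. Suppose that the reflection of the $(K,T)$-billiard at $\partial K$ is a projective billiard reflection: there is a field $\mathcal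 N$ of lines on $\partial K$ transversal to $\partial K$ such that, for every $q\in\partial K$, the map $R_{K,q}$ is the restriction to the oriented lines through $q$ directed outside $K$ of the action of the affine involution of $\mathbb R^n$ that fixes all points of the tangent hyperplane to $\partial K$ at $q$ and acts on the line $\mathcal N(q)$ through $q$ as the central symmetry with respect to $q$. Suppose in addition that the second fundamental form of $\partial T$ is positive definite at every point. Then $\partial T$ is an ellipsoid. -/

import Mathlib

open Set Filter Topology

namespace KTBilliard

/-- The Euclidean space `ℝⁿ`. -/
abbrev E (n : ℕ) := EuclideanSpace ℝ (Fin n)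

/-- `f` is a `C^k` local defining function of the domain `T` at the boundary point `p`: near `p`
the domain is `{f < 0}`, and `f` has nonzero differential at `p`. In particular `∂T = {f = 0}`
near `p`, and the gradient of `f` is an exterior normal. -/
structure IsLocalDefiningFunction {n : ℕ} (k : ℕ∞) (T : Set (E n)) (p : E n) (f : E n → ℝ) :
    Prop where
  contDiffAt : ContDiffAt ℝ k f p
  eq_zero : f p = 0
  fderiv_ne_zero : fderiv ℝ f p ≠ 0
  mem_iff : ∀ᶠ x in 𝓝 p, x ∈ T ↔ f x < 0

/-- The boundary of the domain `T` is a `C^k`-smooth hypersurface. -/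
def HasSmoothBoundary {n : ℕ} (k : ℕ∞) (T : Set (E n)) : Prop :=
  ∀ p ∈ frontier T, ∃ f : E n → ℝ, IsLocalDefiningFunction k T p f

/-- The second fundamental form at `p` of the hypersurface `{f = 0}`, cooriented so that it is
positive on the boundary of the ball `{f < 0}`, `f x = ‖x‖ ^ 2 - 1`. It is to be evaluated on
tangent vectors, i.e. on the kernel of `fderiv ℝ f p`. -/
noncomputable def secondFundamentalForm {n : ℕ} (f : E n → ℝ) (p v w : E n) : ℝ :=
  fderiv ℝ (fderiv ℝ f) p v w / ‖fderiv ℝ f p‖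

/-- The boundary of `T` is `C^k`-smooth and its second fundamental form is positive definite at
every point (on tangent vectors it does not depend on the defining function when `2 ≤ k`). -/
def HasPosDefBoundary {n : ℕ} (k : ℕ∞) (T : Set (E n)) : Prop :=
  ∀ p ∈ frontier T, ∃ f : E n → ℝ, IsLocalDefiningFunction k T p f ∧
    ∀ v : E n, fderiv ℝ f p v = 0 → v ≠ 0 → 0 < secondFundamentalForm f p v v

/-- Bounded strictly convex bodies (open sets) with `C^k`-smooth boundary. Strict convexity is
required of the closure: no segment is contained in the boundary. -/
structure IsConvexBody {n : ℕ} (k : ℕ∞) (K : Set (E n)) : Prop where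
  isOpen : IsOpen K
  nonempty : K.Nonempty
  isBounded : Bornology.IsBounded K
  convex : Convex ℝ K
  strictConvex_closure : StrictConvex ℝ (closure K)
  smooth : HasSmoothBoundary k K

/-- `ν` is the exterior unit normal vector at the boundary point `q` of the convex body `K`
(unique when the boundary of `K` is smooth). -/
def IsExteriorNormal {n : ℕ} (K : Set (E n)) (q ν : E n) : Prop :=
  ‖ν‖ = 1 ∧ ∀ x ∈ K, inner ℝ ν (x - q) ≤ 0

/-- The tangent hyperplane (as a vector subspace) of a hypersurface at a point with normal `ν`. -/
noncomputable def tangentHyperplane {n : ℕ} (ν : E n) : Submodule ℝ (E n) :=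
  (Submodule.span ℝ {ν})ᗮ

/-- The standard symplectic form `∑ dq_j ∧ dp_j` on `ℝ²ⁿ = ℝⁿ_q × ℝⁿ_p`. -/
noncomputable def symplecticForm {n : ℕ} (v w : E n × E n) : ℝ :=
  inner ℝ v.1 w.2 - inner ℝ v.2 w.1

/-- `v` spans the characteristic line of a hypersurface in `ℝ²ⁿ` with tangent space `W`: the kernel
of the restriction to `W` of the symplectic form. -/
def IsCharacteristicVector {n : ℕ} (W : Submodule ℝ (E n × E n)) (v : E n × E n) : Prop :=
  v ∈ W ∧ v ≠ 0 ∧ ∀ w ∈ W, symplecticForm v w = 0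

/-- `v` directs the characteristic line of `∂(K × T)` at the point `z` of
`(K × ∂T) ∪ (∂K × T)`, and it is co-directed with the vector `(n(p), 0)` if `z = (q, p) ∈ K × ∂T`,
respectively with `(0, -n(q))` if `z = (q, p) ∈ ∂K × T`, where `n` is the exterior normal. -/
def IsOrientedCharacteristicVector {n : ℕ} (K T : Set (E n)) (z v : E n × E n) : Prop :=
  (z ∈ K ×ˢ frontier T ∧ ∃ ν : E n, IsExteriorNormal T z.2 ν ∧
      IsCharacteristicVector ((⊤ : Submodule ℝ (E n)).prod (tangentHyperplane ν)) v ∧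
      0 < inner ℝ ν v.1) ∨
  (z ∈ frontier K ×ˢ T ∧ ∃ ν : E n, IsExteriorNormal K z.1 ν ∧
      IsCharacteristicVector ((tangentHyperplane ν).prod (⊤ : Submodule ℝ (E n))) v ∧
      0 < inner ℝ (-ν) v.2)

/-- The curve `γ`, parametrized by the interval `J`, is an orbit of the `(K,T)`-billiard: a
continuous oriented curve in `∂(K × T)` whose intersection with `(K × ∂T) ∪ (∂K × T)` is tangent
to and co-directed with the characteristic line field. -/
def IsBilliardOrbit {n : ℕ} (K T : Set (E n)) (γ : ℝ → E n × E n) (J : Set ℝ) : Prop :=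
  ContinuousOn γ J ∧ (∀ t ∈ J, γ t ∈ frontier (K ×ˢ T)) ∧
    ∀ t ∈ J, γ t ∈ (K ×ˢ frontier T) ∪ (frontier K ×ˢ T) →
      ∃ v, HasDerivWithinAt γ v J t ∧ IsOrientedCharacteristicVector K T (γ t) v

/-- The graph of the reflection map `R_{K,q}` of the `(K,T)`-billiard at `q ∈ ∂K`, an oriented line
through `q` being given by a vector directing it. `R_{K,q}` sends the line directed by `u` to the
line directed by `v` if some `(K,T)`-billiard orbit arrives at `q` along the first line (its
`q`-component being in `K`), then its `q`-component stays at `q` while its `p`-component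
crosses `T`, and then its `q`-component leaves `q` into `K` along the second line. -/
def Reflects {n : ℕ} (K T : Set (E n)) (q u v : E n) : Prop :=
  ∃ (γ : ℝ → E n × E n) (a t₁ t₂ b : ℝ), a < t₁ ∧ t₁ < t₂ ∧ t₂ < b ∧
    IsBilliardOrbit K T γ (Icc a b) ∧
    (∀ t ∈ Ico a t₁, γ t ∈ K ×ˢ frontier T ∧ ∃ s : ℝ, 0 < s ∧ (γ t).1 = q - s • u) ∧
    (∀ t ∈ Ioo t₁ t₂, γ t ∈ frontier K ×ˢ T ∧ (γ t).1 = q) ∧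
    (∀ t ∈ Ioc t₂ b, γ t ∈ K ×ˢ frontier T ∧ ∃ s : ℝ, 0 < s ∧ (γ t).1 = q + s • v)

/-- A projective billiard structure on `∂K`: a field of lines `line q`, `q ∈ ∂K`, transversal to
`∂K` (the values of `line` outside `∂K` are irrelevant). -/
structure ProjectiveBilliard {n : ℕ} (K : Set (E n)) where
  line : E n → Submodule ℝ (E n)
  finrank_line : ∀ q ∈ frontier K, Module.finrank ℝ (line q) = 1
  transversal : ∀ q ∈ frontier K, ∀ ν, IsExteriorNormal K q ν →
    line q ⊓ tangentHyperplane ν = ⊥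

/-- `A` is the reflection involution of a projective billiard at a point `q` with normal vector `ν`
and transversal line `q + ℓ`: the affine map fixing the points of the tangent hyperplane at `q` and
acting on the line `q + ℓ` as the central symmetry with respect to `q`. -/
def IsProjectiveReflection {n : ℕ} (q ν : E n) (ℓ : Submodule ℝ (E n))
    (A : E n →ᵃ[ℝ] E n) : Prop :=
  (∀ v ∈ tangentHyperplane ν, A (q + v) = q + v) ∧ (∀ w ∈ ℓ, A (q + w) = q - w)

/-- The reflection of the `(K,T)`-billiard at `∂K` is a projective billiard reflection: for some
projective billiard structure on `∂K`, at each point `q ∈ ∂K` the map `R_{K,q}` coincides with the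
projective billiard reflection involution on the oriented lines through `q` directed outside `K`. -/
def HasProjectiveReflection {n : ℕ} (K T : Set (E n)) : Prop :=
  ∃ P : ProjectiveBilliard K, ∀ q ∈ frontier K, ∀ ν, IsExteriorNormal K q ν →
    ∃ A : E n →ᵃ[ℝ] E n, IsProjectiveReflection q ν (P.line q) A ∧
      ∀ u v : E n, 0 < inner ℝ ν u →
        (Reflects K T q u v ↔ ∃ c : ℝ, 0 < c ∧ v = c • A.linear u)

/-- `S` is an ellipsoid: `S = {x | ⟨A (x - c), x - c⟩ = 1}` with `A` symmetric positive definite. -/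
def IsEllipsoid {n : ℕ} (S : Set (E n)) : Prop :=
  ∃ (A : E n →ₗ[ℝ] E n) (c : E n), A.IsSymmetric ∧ (∀ x, x ≠ 0 → 0 < inner ℝ (A x) x) ∧
    S = {x | inner ℝ (A (x - c)) (x - c) = 1}

end KTBilliard

namespace KTBilliard

open MeasureTheory

variable {n : ℕ} {K T : Set (E n)}

/-! ### Supporting normals, chords and supergradients of convex sets. -/

section Convexity

/-! Every direction is normal to `∂K` at some `q`. While the orbit rests at `q`, its `p`-component
runs along a chord of `T` in that direction, and the reflection relates the normals of `∂T` at the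
two ends (`reflects_of_chord`). As `R_{K,q}` is one fixed linear reflection, the slopes of `∂T` at
the ends of all parallel chords satisfy one linear relation. Integrating it, in the form of equal
supergradients, makes `T` invariant under an affine reflection along the chords
(`exists_affine_reflection_of_chord_normals`).

So `T` has an affine reflection in every direction. These preserve volume, hence the centroid and
the second moment form, so they are all orthogonal for a single Euclidean structure. The reflection
along `x - y` swaps two points `x`, `y` of equal norm about the centroid, so `T` is a ball of that
structure (`isEllipsoid_frontier_of_affine_reflections`). -/

theorem notMem_of_mem_frontier (hT : IsOpen T) {p : E n} (hp : p ∈ frontier T) : p ∉ T := by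
  rw [hT.frontier_eq] at hp
  exact hp.2

theorem IsExteriorNormal.inner_nonpos_of_mem_closure {p ν : E n} (h : IsExteriorNormal T p ν)
    {x : E n} (hx : x ∈ closure T) : inner ℝ ν (x - p) ≤ 0 := by
  have hc : IsClosed {x : E n | inner ℝ ν (x - p) ≤ 0} :=
    isClosed_le (by fun_prop) continuous_const
  exact closure_minimal (s := T) (fun y hy => h.2 y hy) hc hx

/-- In case of equality a small step along `ν` would stay in `T` and violate the supporting
inequality. -/
theorem IsExteriorNormal.inner_neg_of_mem {p ν : E n} (hT : IsOpen T)
    (h : IsExteriorNormal T p ν) {x : E n} (hx : x ∈ T) : inner ℝ ν (x - p) < 0 := by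
  have hc : Continuous fun t : ℝ => x + t • ν := by fun_prop
  have h0 : ∀ᶠ t : ℝ in 𝓝 0, x + t • ν ∈ T :=
    hc.continuousAt.eventually (hT.mem_nhds (by simpa using hx))
  obtain ⟨t, ht, ht0⟩ := ((h0.filter_mono nhdsWithin_le_nhds).and
    (self_mem_nhdsWithin (a := (0 : ℝ)) (s := Ioi 0))).exists
  have h1 := h.2 _ ht
  have h2 : x + t • ν - p = (x - p) + t • ν := by abel
  rw [h2, inner_add_right, real_inner_smul_right, real_inner_self_eq_norm_sq, h.1] at h1
  have : 0 < t := ht0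
  nlinarith

/-- Every unit vector is an exterior normal of a nonempty bounded open set at some boundary
point. -/
theorem exists_mem_frontier_isExteriorNormal (hK : IsOpen K) (hne : K.Nonempty)
    (hb : Bornology.IsBounded K) {ν : E n} (hν : ‖ν‖ = 1) :
    ∃ q ∈ frontier K, IsExteriorNormal K q ν := by
  obtain ⟨q, hq, hmax⟩ := hb.isCompact_closure.exists_isMaxOn hne.closure
    (f := fun x => inner ℝ ν x) (by fun_prop)
  have hn : IsExteriorNormal K q ν := by
    refine ⟨hν, fun x hx => ?_⟩
    have : inner ℝ ν x ≤ inner ℝ ν q := hmax (subset_closure hx)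
    rw [inner_sub_right]
    linarith
  refine ⟨q, ?_, hn⟩
  rw [hK.frontier_eq]
  refine ⟨hq, fun h => ?_⟩
  simpa using hn.inner_neg_of_mem hK h

theorem exists_isExteriorNormal (hT : IsOpen T) (hc : Convex ℝ T) (hne : T.Nonempty) {p : E n}
    (hp : p ∈ frontier T) : ∃ ν, IsExteriorNormal T p ν := by
  obtain ⟨f, hf⟩ := geometric_hahn_banach_open_point hc hT (notMem_of_mem_frontier hT hp)
  set u := (InnerProductSpace.toDual ℝ (E n)).symm f with hu
  have huf : ∀ x, inner ℝ u x = f x := fun x => InnerProductSpace.toDual_symm_apply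
  have hu0 : u ≠ 0 := by
    intro h0
    obtain ⟨x, hx⟩ := hne
    have h1 := hf x hx
    rw [← huf, ← huf, h0] at h1
    simp at h1
  refine ⟨‖u‖⁻¹ • u, norm_smul_inv_norm hu0, fun x hx => ?_⟩
  rw [real_inner_smul_left, inner_sub_right, huf, huf]
  exact mul_nonpos_of_nonneg_of_nonpos (by positivity) (by linarith [hf x hx])

/-- At a smooth boundary point with exterior normal `ν`, every direction `d` with `⟪ν, d⟫ < 0`
points strictly inside. -/
theorem IsExteriorNormal.exists_add_smul_mem {q ν : E n} {k : ℕ∞} (hk : 1 ≤ k)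
    (hK : HasSmoothBoundary k K) (hq : q ∈ frontier K) (hν : IsExteriorNormal K q ν) {d : E n}
    (hd : inner ℝ ν d < 0) : ∃ δ > 0, ∀ s ∈ Ioc (0 : ℝ) δ, q + s • d ∈ K := by
  obtain ⟨f, hf⟩ := hK q hq
  have hdf : HasFDerivAt f (fderiv ℝ f q) q :=
    (hf.contDiffAt.differentiableAt (by
      have : (1 : WithTop ℕ∞) ≤ (k : WithTop ℕ∞) := by exact_mod_cast hk
      exact (zero_lt_one.trans_le this).ne')).hasFDerivAt
  have key : ∀ e : E n, fderiv ℝ f q e < 0 → ∀ᶠ s in 𝓝[>] (0 : ℝ), q + s • e ∈ K := by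
    intro e he
    have hc : Continuous fun s : ℝ => q + s • e := by fun_prop
    have hmem : ∀ᶠ s in 𝓝 (0 : ℝ), q + s • e ∈ K ↔ f (q + s • e) < 0 := by
      have := hc.tendsto 0
      simp only [zero_smul, add_zero] at this
      exact this.eventually hf.mem_iff
    have hline : HasDerivAt (fun s : ℝ => f (q + s • e)) (fderiv ℝ f q e) 0 :=
      hdf.hasLineDerivAt e
    have hslope := hline.tendsto_slope_zero_right
    filter_upwards [hslope.eventually (gt_mem_nhds he), hmem.filter_mono nhdsWithin_le_nhds,
      self_mem_nhdsWithin] with s hs hs' hs0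
    rw [hs']
    simp only [zero_add, zero_smul, add_zero, hf.eq_zero, sub_zero, smul_eq_mul] at hs
    have hs0 : 0 < s := hs0
    by_contra! hcon
    exact absurd hs (not_lt.mpr (mul_nonneg (by positivity) hcon))
  have key' : ∀ e : E n, fderiv ℝ f q e < 0 → inner ℝ ν e ≤ 0 := by
    intro e he
    obtain ⟨s, hs, hs0⟩ := ((key e he).and self_mem_nhdsWithin).exists
    have hs0 : 0 < s := hs0
    have := hν.2 _ hs
    rw [add_sub_cancel_left, real_inner_smul_right] at this
    by_contra! hcon
    exact absurd this (not_le.mpr (mul_pos hs0 hcon))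
  -- There is no need to identify `ν` with the gradient: otherwise `-d + ε • e` has negative
  -- derivative for all `ε > 0`, and `key'` with `ε → 0` contradicts `⟪ν, d⟫ < 0`.
  have hneg : fderiv ℝ f q d < 0 := by
    by_contra! hcon
    obtain ⟨e, he⟩ : ∃ e, fderiv ℝ f q e < 0 := by
      by_contra! hall
      refine hf.fderiv_ne_zero (ContinuousLinearMap.ext fun e => ?_)
      have h1 := hall e
      have h2 := hall (-e)
      rw [map_neg] at h2
      rw [zero_apply]
      linarith
    have h1 : ∀ ε : ℝ, 0 < ε → inner ℝ ν (-d + ε • e) ≤ 0 := fun ε hε => by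
      apply key'
      rw [map_add, map_neg, map_smul, smul_eq_mul]
      nlinarith
    have hlim : Tendsto (fun ε : ℝ => inner ℝ ν (-d + ε • e)) (𝓝[>] 0) (𝓝 (inner ℝ ν (-d))) := by
      have hc : Continuous fun ε : ℝ => inner ℝ ν (-d + ε • e) := by fun_prop
      have := (hc.tendsto 0).mono_left (nhdsWithin_le_nhds (s := Ioi 0))
      simpa using this
    have h2 := le_of_tendsto hlim (eventually_nhdsWithin_of_forall fun ε hε => h1 ε hε)
    rw [inner_neg_right] at h2
    linarith
  obtain ⟨δ, hδ, h⟩ := mem_nhdsGT_iff_exists_Ioc_subset.mp (key d hneg)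
  exact ⟨δ, hδ, fun s hs => h hs⟩

/-- A ray from a point of a bounded open set meets the boundary. -/
theorem exists_pos_add_smul_mem_frontier (hT : IsOpen T) (hb : Bornology.IsBounded T) {x d : E n}
    (hx : x ∈ T) (hd : d ≠ 0) : ∃ t : ℝ, 0 < t ∧ x + t • d ∈ frontier T := by
  have hcont : Continuous fun t : ℝ => x + t • d := by fun_prop
  have hpre : IsPreconnected ((fun t : ℝ => x + t • d) '' Ici 0) :=
    isPreconnected_Ici.image _ hcont.continuousOn
  obtain ⟨R, hR⟩ := hb.subset_closedBall x
  have hd' : 0 < ‖d‖ := norm_pos_iff.mpr hd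
  have hout : (((fun t : ℝ => x + t • d) '' Ici 0) ∩ Tᶜ).Nonempty := by
    refine ⟨x + ((|R| + 1) / ‖d‖) • d, ⟨_, ?_, rfl⟩, fun hmem => ?_⟩
    · exact mem_Ici.mpr (by positivity)
    · have h1 := hR hmem
      rw [Metric.mem_closedBall, dist_eq_norm, add_sub_cancel_left, norm_smul, Real.norm_eq_abs,
        abs_of_nonneg (by positivity), div_mul_cancel₀ _ hd'.ne'] at h1
      linarith [le_abs_self R]
  have hin : (((fun t : ℝ => x + t • d) '' Ici 0) ∩ T).Nonempty :=
    ⟨x, ⟨0, self_mem_Ici, by simp⟩, hx⟩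
  obtain ⟨y, ⟨t, ht, rfl⟩, hy⟩ :
      (((fun t : ℝ => x + t • d) '' Ici 0) ∩ frontier T).Nonempty := by
    -- A ray missing the frontier would be disconnected by `T` and the complement of its closure.
    by_contra hemp
    have hcl : ∀ y ∈ (fun t : ℝ => x + t • d) '' Ici 0, y ∉ T → y ∈ (closure T)ᶜ :=
      fun y hy hyT hyc => hemp ⟨y, hy, by rw [hT.frontier_eq]; exact ⟨hyc, hyT⟩⟩
    obtain ⟨y, -, hyT, hyc⟩ := hpre T (closure T)ᶜ hT isClosed_closure.isOpen_compl
      (fun y hy => or_iff_not_imp_left.mpr (hcl y hy)) hin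
      (hout.mono fun y hy => ⟨hy.1, hcl y hy.1 hy.2⟩)
    exact hyc (subset_closure hyT)
  refine ⟨t, lt_of_le_of_ne ht ?_, hy⟩
  rintro rfl
  exact notMem_of_mem_frontier hT hy (by simpa using hx)

theorem add_smul_mem_of_lt (hT : IsOpen T) (hc : Convex ℝ T) {x d : E n} {s t : ℝ}
    (hx : x ∈ T) (hy : x + t • d ∈ closure T) (hs : 0 ≤ s) (hst : s < t) : x + s • d ∈ T := by
  have ht : 0 < t := hs.trans_lt hst
  rcases hs.eq_or_lt with rfl | hs
  · simpa using hx
  have h := hc.openSegment_interior_closure_subset_interior (hT.interior_eq.symm ▸ hx) hy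
  rw [hT.interior_eq] at h
  apply h
  refine ⟨1 - s / t, s / t, by rw [sub_pos, div_lt_one ht]; exact hst, by positivity, by ring, ?_⟩
  rw [smul_add, smul_smul, div_mul_cancel₀ _ ht.ne', ← add_assoc, ← add_smul]
  simp

/-- Two functions on a convex set with a common choice of supergradients differ by a constant. -/
theorem sub_eq_sub_of_supergradient (hc : Convex ℝ T) {f g : E n → ℝ} {G : E n → E n}
    (hf : ∀ x ∈ T, ∀ y ∈ T, f y - f x ≤ inner ℝ (G x) (y - x))
    (hg : ∀ x ∈ T, ∀ y ∈ T, g y - g x ≤ inner ℝ (G x) (y - x)) {x y : E n} (hx : x ∈ T)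
    (hy : y ∈ T) : f y - f x = g y - g x := by
  have main : ∀ {f g : E n → ℝ}, (∀ x ∈ T, ∀ y ∈ T, f y - f x ≤ inner ℝ (G x) (y - x)) →
      (∀ x ∈ T, ∀ y ∈ T, g y - g x ≤ inner ℝ (G x) (y - x)) → f y - f x ≤ g y - g x := by
    intro f g hf hg
    have step : ∀ N : ℕ, (f y - f x) - (g y - g x) ≤
        inner ℝ (G x - G y) (y - x) * (1 / ((N : ℝ) + 1)) := by
      intro N
      set P : ℕ → E n := fun i => x + ((i : ℝ) / (N + 1)) • (y - x) with hP
      have hmem : ∀ i ≤ N + 1, P i ∈ T := by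
        intro i hi
        apply hc.add_smul_sub_mem hx hy
        have : (i : ℝ) ≤ N + 1 := by exact_mod_cast hi
        exact ⟨by positivity, (div_le_one (by positivity)).mpr this⟩
      have hdiff : ∀ i, P (i + 1) - P i = (1 / ((N : ℝ) + 1)) • (y - x) := by
        intro i
        simp only [hP]
        rw [add_sub_add_left_eq_sub, ← sub_smul]
        congr 1
        push_cast
        ring
      -- Each increment of `f` is bounded by the slope at its left end, that of `g` from below by
      -- the slope at its right end. The differences telescope, so the error is `O(1 / N)` with no
      -- regularity of `G`.
      have hind : ∀ j ≤ N + 1, (f (P j) - f (P 0)) - (g (P j) - g (P 0)) ≤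
          inner ℝ (G (P 0) - G (P j)) (y - x) * (1 / ((N : ℝ) + 1)) := by
        intro j
        induction j with
        | zero => intro _; simp
        | succ j ih =>
          intro hj
          have h0 := ih (by omega)
          have h1 := hf _ (hmem j (by omega)) _ (hmem (j + 1) hj)
          have h2 := hg _ (hmem (j + 1) hj) _ (hmem j (by omega))
          rw [← neg_sub (P (j + 1)), inner_neg_right] at h2
          rw [hdiff, real_inner_smul_right] at h1 h2
          rw [inner_sub_left] at h0 ⊢
          linarith
      have h := hind (N + 1) le_rfl
      have e0 : P 0 = x := by simp [hP]
      have e1 : P (N + 1) = y := by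
        have : ((N : ℝ) + 1) ≠ 0 := by positivity
        simp [hP, div_self this]
      rwa [e0, e1] at h
    have hlim := (tendsto_one_div_add_atTop_nhds_zero_nat (𝕜 := ℝ)).const_mul
      (inner ℝ (G x - G y) (y - x))
    rw [mul_zero] at hlim
    have := ge_of_tendsto' hlim step
    linarith
  exact le_antisymm (main hf hg) (main hg hf)

end Convexity

/-! ### Explicit orbits and the linear form of the reflection. -/

section Orbit

/-- The form pairs `(ν, 0)` with `(a, b)` to `⟪ν, b⟫`, which vanishes for `b` tangent to `∂T`. -/
theorem IsExteriorNormal.isOrientedCharacteristicVector_right {q p ν : E n} (hq : q ∈ K)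
    (hp : p ∈ frontier T) (hν : IsExteriorNormal T p ν) :
    IsOrientedCharacteristicVector K T (q, p) (ν, 0) := by
  have h0 : ν ≠ 0 := norm_ne_zero_iff.mp (by rw [hν.1]; exact one_ne_zero)
  refine Or.inl ⟨⟨hq, hp⟩, ν, hν, ⟨⟨trivial, zero_mem _⟩, ?_, ?_⟩, ?_⟩
  · simp [h0]
  · rintro ⟨a, b⟩ ⟨-, hb⟩
    have := Submodule.mem_orthogonal_singleton_iff_inner_right.mp hb
    simpa [symplecticForm] using this
  · simp only [real_inner_self_eq_norm_sq, hν.1]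
    norm_num

theorem IsExteriorNormal.isOrientedCharacteristicVector_left {q p ν : E n} (hq : q ∈ frontier K)
    (hp : p ∈ T) (hν : IsExteriorNormal K q ν) :
    IsOrientedCharacteristicVector K T (q, p) (0, -ν) := by
  have h0 : ν ≠ 0 := norm_ne_zero_iff.mp (by rw [hν.1]; exact one_ne_zero)
  refine Or.inr ⟨⟨hq, hp⟩, ν, hν, ⟨⟨zero_mem _, trivial⟩, ?_, ?_⟩, ?_⟩
  · simp [h0]
  · rintro ⟨a, b⟩ ⟨ha, -⟩
    have := Submodule.mem_orthogonal_singleton_iff_inner_right.mp ha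
    simpa [symplecticForm] using this
  · simp only [inner_neg_neg, real_inner_self_eq_norm_sq, hν.1]
    norm_num

/-- The reflection at `q` maps the exterior normal at one end of a chord of `T` parallel to the
normal of `K` at `q` to the exterior normal at the other end. -/
theorem reflects_of_chord (hK : IsOpen K) (hT : IsOpen T) {q ν p n₀ n₁ : E n} {l : ℝ}
    (hl : 0 < l) (hq : q ∈ frontier K) (hν : IsExteriorNormal K q ν)
    (hp₀ : p ∈ frontier T) (hn₀ : IsExteriorNormal T p n₀)
    (hp₁ : p - l • ν ∈ frontier T) (hn₁ : IsExteriorNormal T (p - l • ν) n₁)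
    (hchord : ∀ t ∈ Ioo 0 l, p - t • ν ∈ T)
    (harr : ∃ δ > 0, ∀ s ∈ Ioc (0 : ℝ) δ, q + s • (-n₀) ∈ K)
    (hdep : ∃ δ > 0, ∀ s ∈ Ioc (0 : ℝ) δ, q + s • n₁ ∈ K) : Reflects K T q n₀ n₁ := by
  obtain ⟨a, ha, harr⟩ := harr
  obtain ⟨b, hb, hdep⟩ := hdep
  -- Three linear pieces glued by clamping: `q` moves along `n₀` for `t ≤ 0`, `p` along `-ν` on `[0,
  -- l]`, `q` along `n₁` for `t ≥ l`.
  set γ : ℝ → E n × E n := fun t =>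
    (q + min t 0 • n₀ + max (t - l) 0 • n₁, p - max 0 (min t l) • ν) with hγ
  have e₁ : ∀ t ≤ 0, γ t = (q + t • n₀, p) := fun t ht => by
    simp [hγ, min_eq_left ht, max_eq_right (by linarith : t - l ≤ 0),
      min_eq_left (by linarith : t ≤ l), max_eq_left ht]
  have e₂ : ∀ t ∈ Icc 0 l, γ t = (q, p - t • ν) := fun t ht => by
    simp [hγ, min_eq_right ht.1, max_eq_right (by linarith [ht.2] : t - l ≤ 0),
      min_eq_left ht.2, max_eq_right ht.1]
  have e₃ : ∀ t ≥ l, γ t = (q + (t - l) • n₁, p - l • ν) := fun t ht => by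
    simp [hγ, min_eq_right (by linarith : 0 ≤ t), max_eq_left (by linarith : 0 ≤ t - l),
      min_eq_right ht, max_eq_right hl.le]
  have m₁ : ∀ t ∈ Ico (-a) 0, q + t • n₀ ∈ K := fun t ht => by
    have := harr (-t) ⟨by linarith [ht.2], by linarith [ht.1]⟩
    rwa [neg_smul_neg] at this
  have m₃ : ∀ t ∈ Ioc l (l + b), q + (t - l) • n₁ ∈ K := fun t ht =>
    hdep _ ⟨by linarith [ht.1], by linarith [ht.2]⟩
  have hqK := notMem_of_mem_frontier hK hq
  have hcases : ∀ t ∈ Icc (-a) (l + b), t ∈ Ico (-a) 0 ∨ t = 0 ∨ t ∈ Ioo 0 l ∨ t = l ∨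
      t ∈ Ioc l (l + b) := fun t ht => by
    rcases lt_trichotomy t 0 with h | h | h
    · exact Or.inl ⟨ht.1, h⟩
    · exact Or.inr (Or.inl h)
    · rcases lt_trichotomy t l with h' | h' | h'
      · exact Or.inr (Or.inr (Or.inl ⟨h, h'⟩))
      · exact Or.inr (Or.inr (Or.inr (Or.inl h')))
      · exact Or.inr (Or.inr (Or.inr (Or.inr ⟨h', ht.2⟩)))
  have e0 : γ 0 = (q, p) := by simpa using e₁ 0 le_rfl
  have el : γ l = (q, p - l • ν) := e₂ l ⟨hl.le, le_rfl⟩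
  refine ⟨γ, -a, 0, l, l + b, by linarith, hl, by linarith, ⟨?_, ?_, ?_⟩, ?_, ?_, ?_⟩
  · exact Continuous.continuousOn (by fun_prop)
  · intro t ht
    rw [frontier_prod_eq]
    rcases hcases t ht with h | rfl | h | rfl | h
    · rw [e₁ t h.2.le]
      exact Or.inl ⟨subset_closure (m₁ t h), hp₀⟩
    · rw [e0]
      exact Or.inr ⟨hq, frontier_subset_closure hp₀⟩
    · rw [e₂ t (Ioo_subset_Icc_self h)]
      exact Or.inr ⟨hq, subset_closure (hchord t h)⟩
    · rw [el]
      exact Or.inr ⟨hq, frontier_subset_closure hp₁⟩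
    · rw [e₃ t h.1.le]
      exact Or.inl ⟨subset_closure (m₃ t h), hp₁⟩
  · intro t ht hmem
    rcases hcases t ht with h | rfl | h | rfl | h
    · refine ⟨(n₀, 0), ?_, ?_⟩
      · have hd : HasDerivAt (fun t : ℝ => (q + t • n₀, p)) (n₀, 0) t := by
          have h1 := ((hasDerivAt_id t).smul_const n₀).const_add q
          rw [one_smul] at h1
          exact h1.prodMk (hasDerivAt_const t p)
        refine (hd.congr_of_eventuallyEq ?_).hasDerivWithinAt
        filter_upwards [Iio_mem_nhds h.2] with s hs using e₁ s (le_of_lt hs)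
      · rw [e₁ t h.2.le]
        exact hn₀.isOrientedCharacteristicVector_right (m₁ t h) hp₀
    -- The corner lies in `∂K × ∂T`, where the tangency condition is void.
    · rw [e0] at hmem
      rcases hmem with h | h
      · exact absurd h.1 hqK
      · exact absurd h.2 (notMem_of_mem_frontier hT hp₀)
    · refine ⟨(0, -ν), ?_, ?_⟩
      · have hd : HasDerivAt (fun t : ℝ => (q, p - t • ν)) (0, -ν) t := by
          have h1 := ((hasDerivAt_id t).smul_const ν).const_sub p
          rw [one_smul] at h1
          exact (hasDerivAt_const t q).prodMk h1
        refine (hd.congr_of_eventuallyEq ?_).hasDerivWithinAt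
        filter_upwards [Ioo_mem_nhds h.1 h.2] with s hs using e₂ s (Ioo_subset_Icc_self hs)
      · rw [e₂ t (Ioo_subset_Icc_self h)]
        exact hν.isOrientedCharacteristicVector_left hq (hchord t h)
    · rw [el] at hmem
      rcases hmem with h | h
      · exact absurd h.1 hqK
      · exact absurd h.2 (notMem_of_mem_frontier hT hp₁)
    · refine ⟨(n₁, 0), ?_, ?_⟩
      · have hd : HasDerivAt (fun t : ℝ => (q + (t - l) • n₁, p - l • ν)) (n₁, 0) t := by
          have h1 := (((hasDerivAt_id t).sub_const l).smul_const n₁).const_add q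
          rw [one_smul] at h1
          exact h1.prodMk (hasDerivAt_const t _)
        refine (hd.congr_of_eventuallyEq ?_).hasDerivWithinAt
        filter_upwards [Ioi_mem_nhds h.1] with s hs using e₃ s (le_of_lt hs)
      · rw [e₃ t h.1.le]
        exact hn₁.isOrientedCharacteristicVector_right (m₃ t h) hp₁
  · intro t ht
    rw [e₁ t ht.2.le]
    exact ⟨⟨m₁ t ht, hp₀⟩, -t, by linarith [ht.2], by simp⟩
  · intro t ht
    rw [e₂ t (Ioo_subset_Icc_self ht)]
    exact ⟨⟨hq, hchord t ht⟩, rfl⟩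
  · intro t ht
    rw [e₃ t ht.1.le]
    exact ⟨⟨m₃ t ht, hp₁⟩, t - l, by linarith [ht.1], rfl⟩

/-- The linear part of the projective reflection at a point with normal `ν`. -/
theorem IsProjectiveReflection.exists_linear_eq {q ν : E n} {ℓ : Submodule ℝ (E n)}
    {A : E n →ᵃ[ℝ] E n} (hℓ : Module.finrank ℝ ℓ = 1)
    (htr : ℓ ⊓ tangentHyperplane ν = ⊥) (hA : IsProjectiveReflection q ν ℓ A) :
    ∃ w, inner ℝ ν w = 1 ∧ ∀ u, A.linear u = u - (2 * inner ℝ ν u) • w := by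
  obtain ⟨⟨w₀, hw₀⟩, hne, -⟩ := finrank_eq_one_iff'.mp hℓ
  have hne' : w₀ ≠ 0 := fun h => hne (Subtype.ext h)
  have hi : inner ℝ ν w₀ ≠ 0 := fun h => by
    have hmem : w₀ ∈ ℓ ⊓ tangentHyperplane ν :=
      ⟨hw₀, Submodule.mem_orthogonal_singleton_iff_inner_right.mpr h⟩
    rw [htr] at hmem
    exact hne' ((Submodule.mem_bot ℝ).mp hmem)
  set w := (inner ℝ ν w₀)⁻¹ • w₀ with hw
  have hwl : w ∈ ℓ := ℓ.smul_mem _ hw₀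
  have hw1 : inner ℝ ν w = 1 := by rw [hw, real_inner_smul_right, inv_mul_cancel₀ hi]
  have hAq : A q = q := by simpa using hA.1 0 (zero_mem _)
  have hlin : ∀ v, A.linear v = A (q + v) - q := fun v => by
    have := A.map_vadd q v
    rw [vadd_eq_add, vadd_eq_add, hAq, add_comm v q] at this
    rw [this, add_sub_cancel_right]
  refine ⟨w, hw1, fun u => ?_⟩
  have h1 : A.linear (u - inner ℝ ν u • w) = u - inner ℝ ν u • w := by
    rw [hlin, hA.1 _ (Submodule.mem_orthogonal_singleton_iff_inner_right.mpr (by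
      rw [inner_sub_right, real_inner_smul_right, hw1]; ring)), add_sub_cancel_left]
  have h2 : A.linear (inner ℝ ν u • w) = -(inner ℝ ν u • w) := by
    rw [hlin, hA.2 _ (ℓ.smul_mem _ hwl)]
    abel
  calc A.linear u = A.linear ((u - inner ℝ ν u • w) + inner ℝ ν u • w) := by rw [sub_add_cancel]
    _ = u - (2 * inner ℝ ν u) • w := by
      rw [map_add, h1, h2, two_mul, add_smul]
      abel

end Orbit

/-! ### From chord normals to affine symmetries of `T`. -/

section Reflection

/-- If the normals at the ends of the chords of `T` parallel to `ν` are related by a fixed linear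
reflection, then `T` is invariant under an affine reflection in the direction `ν`. -/
theorem exists_affine_reflection_of_chord_normals (hT : IsOpen T) (hc : Convex ℝ T)
    (hb : Bornology.IsBounded T) {ν w : E n} (hν : ν ≠ 0) (hw : inner ℝ ν w = 1)
    (h : ∀ (p n₀ n₁ : E n) (l : ℝ), 0 < l → p ∈ frontier T → p - l • ν ∈ frontier T →
      (∀ t ∈ Ioo 0 l, p - t • ν ∈ T) → IsExteriorNormal T p n₀ →
      IsExteriorNormal T (p - l • ν) n₁ →
      ∃ c : ℝ, 0 < c ∧ n₁ = c • (n₀ - (2 * inner ℝ ν n₀) • w)) :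
    ∃ k : ℝ, ∀ x ∈ T, x + (k - 2 * inner ℝ w x) • ν ∈ T := by
  rcases T.eq_empty_or_nonempty with rfl | ⟨x₀, hx₀⟩
  · simp
  have hν' : -ν ≠ 0 := neg_ne_zero.mpr hν
  -- `g x` and `f x` measure, in units of `ν`, how far `x` is from the boundary along `ν` and `-ν`.
  choose! g hg0 hg using fun x (hx : x ∈ T) => exists_pos_add_smul_mem_frontier hT hb hx hν
  choose! f hf0 hf using fun x (hx : x ∈ T) => exists_pos_add_smul_mem_frontier hT hb hx hν'
  choose! N hN using fun p (hp : p ∈ frontier T) => exists_isExteriorNormal hT hc ⟨x₀, hx₀⟩ hp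
  have hchord : ∀ x ∈ T, ∀ t, -f x < t → t < g x → x + t • ν ∈ T := by
    intro x hx t h1 h2
    rcases le_total 0 t with h0 | h0
    · exact add_smul_mem_of_lt hT hc hx (frontier_subset_closure (hg x hx)) h0 h2
    · have := add_smul_mem_of_lt hT hc hx (frontier_subset_closure (hf x hx))
        (neg_nonneg.mpr h0) (by linarith)
      rwa [neg_smul_neg] at this
  -- The slope of the supporting hyperplane at the upper end of the chord through `x`, viewed as a
  -- graph over `ν`.
  set G : E n → E n := fun x =>
    (-(inner ℝ (N (x + g x • ν)) ν)⁻¹) • N (x + g x • ν) with hG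
  have hpos : ∀ x ∈ T, 0 < inner ℝ (N (x + g x • ν)) ν := by
    intro x hx
    have := (hN _ (hg x hx)).inner_neg_of_mem hT hx
    rw [sub_add_cancel_left, inner_neg_right, real_inner_smul_right] at this
    exact pos_of_mul_pos_right (by linarith) (hg0 x hx).le
  have hgG : ∀ x ∈ T, ∀ y ∈ T, g y - g x ≤ inner ℝ (G x) (y - x) := by
    intro x hx y hy
    have h1 := (hN _ (hg x hx)).inner_nonpos_of_mem_closure (frontier_subset_closure (hg y hy))
    have e : y + g y • ν - (x + g x • ν) = (y - x) + (g y - g x) • ν := by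
      rw [sub_smul]; abel
    rw [e, inner_add_right, real_inner_smul_right] at h1
    have hp := hpos x hx
    rw [hG, real_inner_smul_left, neg_mul, ← mul_neg, ← div_eq_inv_mul, le_div_iff₀ hp]
    linarith
  -- The reflected normal supports `T` at the lower end. Since `⟪ν, w⟫ = 1`, its `ν`-component is
  -- minus that of the upper normal up to the factor `c`, and the `w` term becomes the linear
  -- correction to `f`.
  have hfG : ∀ x ∈ T, ∀ y ∈ T, (f y - 2 * inner ℝ w y) - (f x - 2 * inner ℝ w x) ≤
      inner ℝ (G x) (y - x) := by
    intro x hx y hy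
    set p := x + g x • ν with hp
    have ep : p - (g x + f x) • ν = x + f x • -ν := by
      rw [hp, add_smul, smul_neg]; abel
    have hfx := hf x hx
    rw [← ep] at hfx
    obtain ⟨c, hc0, hcn⟩ := h p (N p) (N (p - (g x + f x) • ν)) (g x + f x)
      (by linarith [hg0 x hx, hf0 x hx]) (hg x hx) hfx (by
        intro t ht
        have e : p - t • ν = x + (g x - t) • ν := by rw [hp, sub_smul]; abel
        rw [e]
        exact hchord x hx _ (by linarith [ht.2]) (by linarith [ht.1])) (hN _ (hg x hx)) (hN _ hfx)
    have h1 := (hN _ hfx).inner_nonpos_of_mem_closure (frontier_subset_closure (hf y hy))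
    have e : y + f y • -ν - (p - (g x + f x) • ν) = (y - x) - (f y - f x) • ν := by
      rw [ep, sub_smul, smul_neg, smul_neg]; abel
    rw [hcn, e, real_inner_smul_left] at h1
    have h2 := nonpos_of_mul_nonpos_right h1 hc0
    simp only [inner_sub_left, inner_sub_right, real_inner_smul_left, real_inner_smul_right,
      real_inner_comm ν w, real_inner_comm (N p) ν, hw] at h2
    have hp' := hpos x hx
    rw [← hp] at hp'
    simp only [hG]
    rw [← hp, real_inner_smul_left, neg_mul, ← mul_neg, ← div_eq_inv_mul, le_div_iff₀ hp']
    rw [inner_sub_right]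
    nlinarith
  -- With this `k` the displacement `k - 2 * ⟪w, x⟫` equals `g x - f x`: the point moves to its
  -- mirror image within its chord.
  refine ⟨g x₀ - (f x₀ - 2 * inner ℝ w x₀), fun x hx => ?_⟩
  have hconst := sub_eq_sub_of_supergradient hc hgG hfG hx₀ hx
  apply hchord x hx
  · linarith [hg0 x hx]
  · linarith [hf0 x hx]

/-- One boundary point of `K` with normal along `d` governs all chords of `T` parallel to `d`. -/
theorem HasProjectiveReflection.exists_affine_reflection (hK : IsConvexBody 6 K)
    (hT : IsConvexBody 6 T) (h : HasProjectiveReflection K T) {d : E n} (hd : d ≠ 0) :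
    ∃ (w : E n) (k : ℝ), inner ℝ d w = 1 ∧ ∀ x ∈ T, x + (k - 2 * inner ℝ w x) • d ∈ T := by
  have hd0 : 0 < ‖d‖ := norm_pos_iff.mpr hd
  set ν := ‖d‖⁻¹ • d with hνd
  have hν : ‖ν‖ = 1 := norm_smul_inv_norm hd
  have hν0 : ν ≠ 0 := norm_ne_zero_iff.mp (by rw [hν]; exact one_ne_zero)
  obtain ⟨P, hP⟩ := h
  obtain ⟨q, hq, hqν⟩ := exists_mem_frontier_isExteriorNormal hK.isOpen hK.nonempty hK.isBounded hν
  obtain ⟨A, hA, hR⟩ := hP q hq ν hqν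
  obtain ⟨w, hw, hlin⟩ := hA.exists_linear_eq (P.finrank_line q hq) (P.transversal q hq ν hqν)
  obtain ⟨k, hk⟩ := exists_affine_reflection_of_chord_normals hT.isOpen hT.convex hT.isBounded
    hν0 hw (by
      intro p n₀ n₁ l hl hp₀ hp₁ hchord hn₀ hn₁
      -- An interior point of the chord gives strict signs: `n₀` points out of `K` at `q` and `n₁`
      -- into it.
      have hmid : p - (l / 2) • ν ∈ T := hchord _ ⟨by linarith, by linarith⟩
      have h0 := hn₀.inner_neg_of_mem hT.isOpen hmid
      have h1 := hn₁.inner_neg_of_mem hT.isOpen hmid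
      have e0 : p - (l / 2) • ν - p = (-(l / 2)) • ν := by rw [neg_smul]; abel
      have e1 : p - (l / 2) • ν - (p - l • ν) = (l / 2) • ν := by
        rw [sub_sub_sub_cancel_left, ← sub_smul]
        congr 1
        ring
      rw [e0, real_inner_smul_right, real_inner_comm] at h0
      rw [e1, real_inner_smul_right, real_inner_comm] at h1
      have hout : 0 < inner ℝ ν n₀ := by nlinarith
      have hin : inner ℝ ν n₁ < 0 := by nlinarith
      rw [← hlin]
      exact (hR n₀ n₁ hout).mp (reflects_of_chord hK.isOpen hT.isOpen hl hq hqν hp₀ hn₀ hp₁ hn₁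
        hchord (hqν.exists_add_smul_mem (by norm_num) hK.smooth hq (by
          rw [inner_neg_right]; linarith))
        (hqν.exists_add_smul_mem (by norm_num) hK.smooth hq hin)))
  refine ⟨‖d‖⁻¹ • w, ‖d‖⁻¹ * k, ?_, fun x hx => ?_⟩
  · rw [real_inner_smul_right, ← real_inner_smul_left, hw]
  · have := hk x hx
    rw [hνd, smul_smul] at this
    convert this using 3
    rw [real_inner_smul_left]
    ring

end Reflection

/-! ### Moments, and sets with an affine reflection in every direction. -/

section Ellipsoid

theorem affine_reflection_involutive {d w : E n} {k : ℝ} (hw : inner ℝ d w = 1) :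
    Function.Involutive fun x : E n => x + (k - 2 * inner ℝ w x) • d := by
  intro x
  simp only [inner_add_right, real_inner_smul_right, real_inner_comm d w, hw]
  rw [add_assoc, ← add_smul]
  ring_nf
  simp

/-- The linear part is an involution, so its determinant is `±1`. -/
theorem measurePreserving_affine_reflection {d w : E n} {k : ℝ} (hw : inner ℝ d w = 1) :
    MeasurePreserving (fun x : E n => x + (k - 2 * inner ℝ w x) • d) := by
  let L : E n →ₗ[ℝ] E n := LinearMap.id - (2 : ℝ) • (innerₛₗ ℝ w).smulRight d
  have hL : ∀ x, L x = x - (2 * inner ℝ w x) • d := fun x => by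
    simp [L, mul_smul]
  have hLL : L * L = 1 := by
    ext1 x
    have := affine_reflection_involutive (k := 0) hw x
    simp only [zero_sub, neg_smul, ← sub_eq_add_neg] at this
    rw [Module.End.mul_apply, hL (L x), hL, this]
    rfl
  have hdet : LinearMap.det L * LinearMap.det L = 1 := by rw [← map_mul, hLL, map_one]
  have habs : |LinearMap.det L| = 1 := by
    have h1 : |LinearMap.det L| * |LinearMap.det L| = 1 := by rw [← abs_mul, hdet, abs_one]
    nlinarith [abs_nonneg (LinearMap.det L)]
  have hmp : MeasurePreserving L := by
    refine ⟨L.continuous_of_finiteDimensional.measurable, ?_⟩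
    rw [Measure.map_linearMap_addHaar_eq_smul_addHaar _
      (fun h => by rw [h] at hdet; simp at hdet), abs_inv, habs]
    simp
  have := (measurePreserving_add_right (volume : Measure (E n)) (k • d)).comp hmp
  have e : (fun x : E n => x + (k - 2 * inner ℝ w x) • d) = (fun x => x + k • d) ∘ L := by
    ext1 x
    simp only [Function.comp, hL, sub_smul]
    abel
  rwa [e]

/-- An involution mapping `T` into itself has `T` as its preimage. This yields the invariance of the
moments of `T`. -/
theorem setIntegral_affine_reflection {d w : E n} {k : ℝ} (hw : inner ℝ d w = 1)
    (h : ∀ x ∈ T, x + (k - 2 * inner ℝ w x) • d ∈ T) (F : E n → ℝ) :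
    ∫ x in T, F (x + (k - 2 * inner ℝ w x) • d) = ∫ x in T, F x := by
  have hinv := affine_reflection_involutive (k := k) hw
  set σ : E n → E n := fun x => x + (k - 2 * inner ℝ w x) • d with hσ
  have hcont : Continuous σ := by fun_prop
  have hemb : MeasurableEmbedding σ :=
    (Homeomorph.mk (hinv.toPerm σ) hcont hcont).measurableEmbedding
  have hpre : σ ⁻¹' T = T :=
    Subset.antisymm (fun x hx => hinv x ▸ h (σ x) hx) fun x hx => h x hx
  have := (measurePreserving_affine_reflection (k := k) hw).setIntegral_preimage_emb hemb F T
  rwa [hpre] at this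

/-- The second moment operator of the set `T` about the point `c`. -/
noncomputable def secondMoment (T : Set (E n)) (c u : E n) : E n :=
  ∫ x in T, inner ℝ u (x - c) • (x - c)

theorem integrableOn_of_continuous_of_isBounded {F : Type*} [NormedAddCommGroup F]
    (hb : Bornology.IsBounded T) {f : E n → F} (hf : Continuous f) : IntegrableOn f T :=
  (hf.continuousOn.integrableOn_compact hb.isCompact_closure).mono_set subset_closure

theorem inner_secondMoment (hb : Bornology.IsBounded T) (c u v : E n) :
    inner ℝ v (secondMoment T c u) = ∫ x in T, inner ℝ u (x - c) * inner ℝ v (x - c) := by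
  rw [secondMoment, ← integral_inner (integrableOn_of_continuous_of_isBounded hb (by fun_prop))]
  simp only [real_inner_smul_right]

theorem isLinearMap_secondMoment (hb : Bornology.IsBounded T) (c : E n) :
    IsLinearMap ℝ (secondMoment T c) where
  map_add u v := by
    simp only [secondMoment, inner_add_left, add_smul]
    exact integral_add (integrableOn_of_continuous_of_isBounded hb (by fun_prop))
      (integrableOn_of_continuous_of_isBounded hb (by fun_prop))
  map_smul a u := by
    simp only [secondMoment, real_inner_smul_left, mul_smul]
    exact integral_smul _ _

theorem inner_secondMoment_self_pos (hT : IsOpen T) (hb : Bornology.IsBounded T)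
    (hne : T.Nonempty) (c : E n) {u : E n} (hu : u ≠ 0) :
    0 < inner ℝ u (secondMoment T c u) := by
  rw [inner_secondMoment hb]
  have hcont : Continuous fun x : E n => inner ℝ u (x - c) * inner ℝ u (x - c) := by fun_prop
  rw [setIntegral_pos_iff_support_of_nonneg_ae
    (Eventually.of_forall fun x => mul_self_nonneg _)
    (integrableOn_of_continuous_of_isBounded hb hcont)]
  refine (hcont.isOpen_support.inter hT).measure_pos volume ?_
  obtain ⟨x, hx⟩ := hne
  -- If the integrand vanishes at `x`, a small step along `u` leaves its zero set but not `T`.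
  by_cases h : inner ℝ u (x - c) = 0
  · have hc : Continuous fun t : ℝ => x + t • u := by fun_prop
    have h0 : ∀ᶠ t : ℝ in 𝓝 0, x + t • u ∈ T :=
      hc.continuousAt.eventually (hT.mem_nhds (by simpa using hx))
    obtain ⟨t, ht, ht0⟩ := ((h0.filter_mono nhdsWithin_le_nhds).and
      (self_mem_nhdsWithin (a := (0 : ℝ)) (s := Ioi 0))).exists
    have ht0 : 0 < t := ht0
    refine ⟨x + t • u, ?_, ht⟩
    have e : x + t • u - c = (x - c) + t • u := by abel
    have hpos : 0 < t * ‖u‖ ^ 2 := by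
      have := norm_pos_iff.mpr hu
      positivity
    rw [Function.mem_support, e, inner_add_right, h, real_inner_smul_right,
      real_inner_self_eq_norm_sq, zero_add]
    exact (mul_pos hpos hpos).ne'
  · exact ⟨x, mul_ne_zero h h, hx⟩

/-- A bounded convex open set that is invariant under an affine reflection in every direction
is bounded by an ellipsoid: the reflections are orthogonal with respect to the inverse of the
second moment form about the centroid. -/
theorem isEllipsoid_frontier_of_affine_reflections (hT : IsOpen T) (hc : Convex ℝ T)
    (hb : Bornology.IsBounded T) (hne : T.Nonempty)
    (h : ∀ d : E n, d ≠ 0 →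
      ∃ (w : E n) (k : ℝ), inner ℝ d w = 1 ∧ ∀ x ∈ T, x + (k - 2 * inner ℝ w x) • d ∈ T) :
    IsEllipsoid (frontier T) := by
  have hvol : 0 < volume.real T :=
    ENNReal.toReal_pos (hT.measure_pos volume hne).ne' hb.measure_lt_top.ne
  set c : E n := (volume.real T)⁻¹ • ∫ x in T, x with hcdef
  have hcentroid : ∀ w : E n, ∫ x in T, inner ℝ w x = volume.real T * inner ℝ w c := by
    intro w
    rw [hcdef, real_inner_smul_right, mul_inv_cancel_left₀ hvol.ne']
    exact integral_inner (integrableOn_of_continuous_of_isBounded hb continuous_id) w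
  let S : E n →ₗ[ℝ] E n := (isLinearMap_secondMoment hb c).mk'
  have hSB : ∀ u v, inner ℝ v (S u) = ∫ x in T, inner ℝ u (x - c) * inner ℝ v (x - c) :=
    fun u v => inner_secondMoment hb c u v
  have hSpos : ∀ u, u ≠ 0 → 0 < inner ℝ u (S u) := fun u hu =>
    inner_secondMoment_self_pos hT hb hne c hu
  have hSsymm : ∀ u v, inner ℝ v (S u) = inner ℝ u (S v) := fun u v => by
    rw [hSB, hSB]
    simp only [mul_comm]
  have hSinj : Function.Injective S := by
    rw [← LinearMap.ker_eq_bot, LinearMap.ker_eq_bot']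
    intro u hu
    by_contra h0
    have := hSpos u h0
    rw [hu, inner_zero_right] at this
    exact this.false
  let e : E n ≃ₗ[ℝ] E n := LinearEquiv.ofInjectiveEndo S hSinj
  let Q : E n →ₗ[ℝ] E n := e.symm.toLinearMap
  have hSQ : ∀ x, S (Q x) = x := fun x => e.apply_symm_apply x
  have hQS : ∀ x, Q (S x) = x := fun x => e.symm_apply_apply x
  have hQsymm : ∀ x y, inner ℝ (Q x) y = inner ℝ (Q y) x := fun x y => by
    have := hSsymm (Q y) (Q x)
    rwa [hSQ, hSQ] at this
  have hQpos : ∀ x, x ≠ 0 → 0 < inner ℝ (Q x) x := fun x hx => by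
    have hne : Q x ≠ 0 := fun h0 => hx (by rw [← hSQ x, h0, map_zero])
    have := hSpos _ hne
    rwa [hSQ] at this
  have hrefl : ∀ d : E n, d ≠ 0 → ∀ x ∈ T,
      x - (2 * inner ℝ (Q d) (x - c) / inner ℝ (Q d) d) • d ∈ T := by
    intro d hd x hx
    obtain ⟨w, k, hw, hσ⟩ := h d hd
    -- The reflection sends `⟪w, x⟫` to `k - ⟪w, x⟫`; averaging over `T` puts the centroid on the
    -- mirror.
    have hk : k = 2 * inner ℝ w c := by
      have h1 := setIntegral_affine_reflection hw hσ fun x => inner ℝ w x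
      simp only [inner_add_right, real_inner_smul_right, real_inner_comm d w, hw, mul_one] at h1
      have h2 : ∀ x : E n, inner ℝ w x + (k - 2 * inner ℝ w x) = k - inner ℝ w x := fun x => by ring
      simp only [h2] at h1
      rw [integral_sub (integrableOn_of_continuous_of_isBounded hb continuous_const)
        (integrableOn_of_continuous_of_isBounded hb (by fun_prop)), hcentroid,
        setIntegral_const, smul_eq_mul] at h1
      have h3 : volume.real T * (k - 2 * inner ℝ w c) = 0 := by linarith
      rcases mul_eq_zero.mp h3 with h4 | h4
      · exact absurd h4 hvol.ne'
      · linarith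
    -- The reflection flips `⟪w, x - c⟫` and fixes `⟪u, x - c⟫`, so the mixed moment equals its
    -- negative.
    have horth : ∀ u, inner ℝ d u = 0 → inner ℝ u (S w) = 0 := by
      intro u hu
      have h1 := setIntegral_affine_reflection hw hσ fun x => inner ℝ w (x - c) * inner ℝ u (x - c)
      have h2 : ∀ x : E n, inner ℝ w (x + (k - 2 * inner ℝ w x) • d - c) *
          inner ℝ u (x + (k - 2 * inner ℝ w x) • d - c) =
          -(inner ℝ w (x - c) * inner ℝ u (x - c)) := fun x => by
        simp only [inner_sub_right, inner_add_right, real_inner_smul_right, real_inner_comm d w,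
          hw, real_inner_comm d u, hu, hk]
        ring
      simp only [h2] at h1
      rw [integral_neg, ← hSB] at h1
      linarith
    -- Hence `w` is a multiple of `Q d`: the reflection is the `Q`-orthogonal one.
    have hSw : S w = inner ℝ w (S w) • d := by
      have hd2 : inner ℝ d d ≠ 0 := inner_self_ne_zero.mpr hd
      have hmem : S w ∈ ((ℝ ∙ d)ᗮ)ᗮ := by
        rw [Submodule.mem_orthogonal]
        exact fun u hu => horth u (Submodule.mem_orthogonal_singleton_iff_inner_right.mp hu)
      rw [Submodule.orthogonal_orthogonal, Submodule.mem_span_singleton] at hmem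
      obtain ⟨a, ha⟩ := hmem
      rw [← ha, real_inner_smul_right, real_inner_comm d w, hw, mul_one]
    have hw0 : w ≠ 0 := fun h0 => by simp [h0] at hw
    have hlam := hSpos w hw0
    set lam : ℝ := inner ℝ w (S w) with hlamdef
    have hwQ : w = lam • Q d := by rw [← map_smul, ← hSw, hQS]
    have hwd : lam * inner ℝ (Q d) d = 1 := by
      rw [← real_inner_smul_left, ← hwQ, real_inner_comm, hw]
    have hQd := hQpos d hd
    have := hσ x hx
    rw [sub_eq_add_neg, ← neg_smul]
    convert this using 3
    have hwx : ∀ y, inner ℝ w y = lam * inner ℝ (Q d) y := fun y => by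
      rw [← real_inner_smul_left, ← hwQ]
    have hlam' : lam = (inner ℝ (Q d) d)⁻¹ := eq_inv_of_mul_eq_one_left hwd
    rw [hk, hwx, hwx, inner_sub_right, hlam']
    field_simp
    ring
  -- Points on one `Q`-sphere about `c` are swapped by the `Q`-orthogonal reflection along `x - y`.
  have hlevel : ∀ x y : E n, inner ℝ (Q (x - c)) (x - c) = inner ℝ (Q (y - c)) (y - c) →
      x ∈ T → y ∈ T := by
    intro x y hxy hx
    rcases eq_or_ne x y with rfl | hne
    · exact hx
    have hd : x - y ≠ 0 := sub_ne_zero.mpr hne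
    have h1 := hrefl (x - y) hd x hx
    have hpos := hQpos _ hd
    have e1 : inner ℝ (Q (x - y)) (x - y) = 2 * inner ℝ (Q (x - y)) (x - c) := by
      have e : x - y = (x - c) - (y - c) := by abel
      rw [e, map_sub, inner_sub_right, inner_sub_left, inner_sub_left, hQsymm (y - c) (x - c), ← hxy]
      ring
    rw [← e1, div_self hpos.ne', one_smul, sub_sub_cancel] at h1
    exact h1
  -- The antipode `c + c - x` lies on the `Q`-sphere of `x`, and `c` is their midpoint.
  have hcT : c ∈ T := by
    obtain ⟨x, hx⟩ := hne
    have h1 : c + c - x ∈ T := hlevel x _ (by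
      have e : c + c - x - c = -(x - c) := by abel
      rw [e, map_neg, inner_neg_neg]) hx
    have h2 := hc hx h1 (by norm_num : (0 : ℝ) ≤ 1 / 2) (by norm_num : (0 : ℝ) ≤ 1 / 2)
      (by norm_num)
    rw [← smul_add, add_sub_cancel, ← two_smul ℝ c, smul_smul] at h2
    simpa using h2
  have hcF : ∀ x ∈ frontier T, x - c ≠ 0 := fun x hx h0 =>
    notMem_of_mem_frontier hT hx (sub_eq_zero.mp h0 ▸ hcT)
  have hstar : ∀ x ∈ closure T, ∀ t : ℝ, 0 ≤ t → t < 1 → c + t • (x - c) ∈ T := by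
    intro x hx t h0 h1
    exact add_smul_mem_of_lt hT hc hcT (by rwa [one_smul, add_sub_cancel]) h0 h1
  have hscale : ∀ (x : E n) (t : ℝ), inner ℝ (Q (c + t • (x - c) - c)) (c + t • (x - c) - c) =
      t ^ 2 * inner ℝ (Q (x - c)) (x - c) := fun x t => by
    rw [add_sub_cancel_left, map_smul, real_inner_smul_left, real_inner_smul_right]
    ring
  -- `T` is a union of `Q`-spheres and star-shaped about `c`; radial scaling by the square root of
  -- the ratio of levels moves from one sphere to another.
  have hlt : ∀ x ∈ frontier T, ∀ y, y ∈ T ↔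
      inner ℝ (Q (y - c)) (y - c) < inner ℝ (Q (x - c)) (x - c) := by
    intro x hx y
    have hr := hQpos _ (hcF x hx)
    set r := inner ℝ (Q (x - c)) (x - c) with hrdef
    set s := inner ℝ (Q (y - c)) (y - c) with hsdef
    have hs : 0 ≤ s := by
      rcases eq_or_ne (y - c) 0 with h0 | h0
      · rw [hsdef, h0, inner_zero_right]
      · exact (hQpos _ h0).le
    constructor
    · intro hy
      by_contra! hrs
      have hs' : 0 < s := hr.trans_le hrs
      have hxT : x ∈ T := by
        rcases hrs.eq_or_lt with heq | hlt
        · exact hlevel y x heq.symm hy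
        · refine hlevel (c + Real.sqrt (r / s) • (y - c)) x ?_
            (hstar y (subset_closure hy) _ (Real.sqrt_nonneg _) ?_)
          · rw [hscale, Real.sq_sqrt (by positivity)]
            exact div_mul_cancel₀ _ hs'.ne'
          · rw [Real.sqrt_lt' one_pos, one_pow, div_lt_one hs']
            exact hlt
      exact notMem_of_mem_frontier hT hx hxT
    · intro hsr
      refine hlevel (c + Real.sqrt (s / r) • (x - c)) y ?_
        (hstar x (frontier_subset_closure hx) _ (Real.sqrt_nonneg _) ?_)
      · rw [hscale, Real.sq_sqrt (by positivity)]
        exact div_mul_cancel₀ _ hr.ne'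
      · rw [Real.sqrt_lt' one_pos, one_pow, div_lt_one hr]
        exact hsr
  rcases (frontier T).eq_empty_or_nonempty with hemp | ⟨p, hp⟩
  -- An empty frontier forces dimension zero, where the ellipsoid equation reads `0 = 1`.
  · have hsub : ∀ x : E n, x = 0 := by
      intro x
      by_contra hx
      obtain ⟨t, -, ht⟩ := exists_pos_add_smul_mem_frontier hT hb hcT hx
      rw [hemp] at ht
      exact ht
    refine ⟨Q, c, fun x y => ?_, hQpos, ?_⟩
    · rw [hsub x, hsub y]; simp
    · rw [hemp]
      ext x
      simp [hsub (x - c), -map_sub]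
  · have hr := hQpos _ (hcF p hp)
    set r := inner ℝ (Q (p - c)) (p - c) with hrdef
    refine ⟨r⁻¹ • Q, c, fun x y => ?_, fun x hx => ?_, ?_⟩
    · simp only [LinearMap.smul_apply, real_inner_smul_left, real_inner_smul_right]
      rw [hQsymm, real_inner_comm]
    · rw [LinearMap.smul_apply, real_inner_smul_left]
      exact mul_pos (inv_pos.mpr hr) (hQpos x hx)
    · ext x
      rw [mem_ofPred_eq, LinearMap.smul_apply, real_inner_smul_left, inv_mul_eq_one₀ hr.ne']
      constructor
      · intro hx
        have h1 := mt (hlt p hp x).mpr (notMem_of_mem_frontier hT hx)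
        have h2 := mt (hlt x hx p).mpr (notMem_of_mem_frontier hT hp)
        exact le_antisymm (not_lt.mp h1) (not_lt.mp h2)
      · intro hx
        have hxT : x ∉ T := fun h0 => ((hlt p hp x).mp h0).ne hx.symm
        rw [hT.frontier_eq]
        refine ⟨?_, hxT⟩
        -- A point on the level of `p` is approached radially from lower levels, which lie in `T`.
        have hlim : Tendsto (fun t : ℝ => c + t • (x - c)) (𝓝[<] 1) (𝓝 x) := by
          have hcont : Continuous fun t : ℝ => c + t • (x - c) := by fun_prop
          have := (hcont.tendsto 1).mono_left (nhdsWithin_le_nhds (s := Iio 1))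
          simpa using this
        refine mem_closure_of_tendsto hlim ?_
        filter_upwards [Ioo_mem_nhdsLT (zero_lt_one (α := ℝ))] with t ht
        rw [hlt p hp, hscale, ← hx]
        have : t ^ 2 < 1 := by nlinarith [ht.1, ht.2]
        nlinarith

end Ellipsoid

end KTBilliard

theorem theorem1p9 (n : ℕ) (K T : Set (KTBilliard.E n))
    (hK : KTBilliard.IsConvexBody 6 K) (hT : KTBilliard.IsConvexBody 6 T)
    (hII : KTBilliard.HasPosDefBoundary 6 T)
    (hproj : KTBilliard.HasProjectiveReflection K T) :
    KTBilliard.IsEllipsoid (frontier T) :=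
  KTBilliard.isEllipsoid_frontier_of_affine_reflections hT.isOpen hT.convex hT.isBounded
    hT.nonempty fun _ hd => hproj.exists_affine_reflection hK hT hd
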